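/- Let $P$ be a finite set of points and $B$ a finite set of regions in $\mathbb{R}^d$. Their incidence graph $G(P,B)$ is the bipartite graph with vertex classes $P$ and $B$ in which $p \in P$ and $R \in B$ are adjacent if and only if $p \in R$; the number of incidences $I(P,B)$ is the number of edges of $G(P,B)$. An orthant in $\mathbb{R}^3$ is a product $J_1 \times J_2 \times J_3$ in which each $J_i$ is a closed ray, $(-\infty,q_i]$ or $[q_i,\infty)$ with $q_i \in \mathbb{R}$ (all eight types are allowed, also together in one set $B$). A 3-sided rectangle in $\mathbb{R}^2$ is an axis-parallel set of one of the four forms $[a,b]\times(-\infty,h]$, $[a,b]\times[h,\infty)$, $(-\infty,h]\times[a,b]$, $[h,\infty)\times[a,b]$, with real $a \le b$ and $h$. Then there is an absolute constant $C > 0$ such that the following two statements hold for all integers $k \ge 1$ and $n, m \ge 0$. (i) If $P$ is a set of $n$ points and $B$ is a set of $m$ orthants, both in $\mathbb{R}^3$, and $G(P,B)$ does not contain the complete bipartite graph $K_{k,k}$ as a subgraph, then $I(P,B) \le C\,k\,(n+m)$. (ii) If $P$ is a set of $n$ points and $B$ is a set of $m$ 3-sided rectangles, both in $\mathbb{R}^2$,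 and $G(P,B)$ does not contain $K_{k,k}$ as a subgraph, then $I(P,B) \le C\,k\,(n+m)$. -/

import Mathlib

/-- The incidence graph between a finite set `P` of points and a finite set `B` of regions: the
bipartite graph on the disjoint union of `P` and `B` in which a point is joined to a region exactly
when it lies in it. -/
def incidenceGraph {X : Type*} (P : Finset X) (B : Finset (Set X)) : SimpleGraph (P ⊕ B) where
  Adj u v :=
    match u, v with
    | .inl p, .inr R => (p : X) ∈ (R : Set X)
    | .inr R, .inl p => (p : X) ∈ (R : Set X)
    | .inl _, .inl _ => False
    | .inr _, .inr _ => False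
  symm := ⟨by
    rintro (p | R) (q | S) h
    · exact h
    · exact h
    · exact h
    · exact h⟩
  loopless := ⟨by
    rintro (p | R) h
    · exact h
    · exact h⟩

/-- The number of incidences between `P` and `B`: the number of edges of the incidence graph. -/
noncomputable def numIncidences {X : Type*} (P : Finset X) (B : Finset (Set X)) : ℕ :=
  (incidenceGraph P B).edgeSet.ncard

/-- The incidence graph does not contain `K_{k,k}` as a (not necessarily induced) subgraph. -/
def IncidenceKFree {X : Type*} (k : ℕ) (P : Finset X) (B : Finset (Set X)) : Prop :=
  (completeBipartiteGraph (Fin k) (Fin k)).Free (incidenceGraph P B)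

/-- An orthant of `ℝ³`, of any of the eight types: a product of three closed rays, each of
the form `(-∞, q_i]` or `[q_i, ∞)`. -/
def IsOrthant (R : Set (Fin 3 → ℝ)) : Prop :=
  ∃ (q : Fin 3 → ℝ) (s : Fin 3 → Bool),
    R = {p | ∀ i, if s i then p i ≤ q i else q i ≤ p i}

/-- An axis-parallel 3-sided rectangle of `ℝ²`, of any of the four types: the product of a closed
interval `[a, b]` in one of the coordinates and a closed ray `(-∞, h]` or `[h, ∞)` in the other. -/
def IsThreeSidedRectangle (R : Set (Fin 2 → ℝ)) : Prop :=
  ∃ (i j : Fin 2) (a b h : ℝ), i ≠ j ∧ a ≤ b ∧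
    (R = {p | p i ∈ Set.Icc a b ∧ p j ≤ h} ∨ R = {p | p i ∈ Set.Icc a b ∧ h ≤ p j})

/-! Up to signs and a choice of coordinates, each of the eight types of region in either statement
is three-dimensional dominance `x a ≤ y b`. So it suffices to bound the edges of a `K_{k,k}`-free
dominance graph. Vertices are deleted one at a time: the larger side has a vertex of degree O(k)
(`exists_dominance_degree_lt`), and negation exchanges the sides.

For the degree bound, suppose that there are n points and m ≤ n regions, and that all points have
degree at least 4s, with s a large multiple of k. Raise each point until its degree is exactly 4s;
this only removes edges (`exists_update_card_eq`). Sample the regions at rate 1/(4s). With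
probability at least 1/4 a given point lies in no sampled region, and then it lies above a corner of
the staircase of the sample (`exists_corner_le`). Above a corner with L conflicting regions there
are at most k(L/s + 1)^3 points, by a grid of ranks (`card_le_of_common_conflicts`). Staircases have
linearly many corners (`card_corners_le`), and comparison with sampling at half the rate shows that
the cubic factor costs only a constant on average (`card_le_of_sampling`). Hence n = O(k(m/s + 1)),
which is less than m because m ≥ 4s: a contradiction. -/

/-! ### Random sampling and a Clarkson–Shor bound. -/

/-- Under independent sampling with probability `p`, the probability that the sample of `S` contains
`A` and avoids `B` is `p ^ #A * (1 - p) ^ #B`. -/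
theorem sum_powerset_sampling {β : Type*} [DecidableEq β] {S A B : Finset β} (hA : A ⊆ S)
    (hB : B ⊆ S) (hAB : Disjoint A B) (p : ℝ) :
    ∑ R ∈ S.powerset, (if A ⊆ R ∧ Disjoint B R then p ^ R.card * (1 - p) ^ (S \ R).card else 0) =
      p ^ A.card * (1 - p) ^ B.card := by
  -- Each element contributes a sampled and an unsampled term; zeroing the first on `B` and the
  -- second on `A` kills exactly the unwanted samples.
  have h := Finset.prod_add (fun i => if i ∈ B then (0 : ℝ) else p)
    (fun i => if i ∈ A then (0 : ℝ) else 1 - p) S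
  have h1 : ∏ i ∈ S, ((if i ∈ B then (0 : ℝ) else p) + (if i ∈ A then (0 : ℝ) else 1 - p)) =
      p ^ A.card * (1 - p) ^ B.card := by
    have h2 : ∀ i ∈ S, ((if i ∈ B then (0 : ℝ) else p) + (if i ∈ A then (0 : ℝ) else 1 - p)) =
        (if i ∈ A then p else 1) * (if i ∈ B then 1 - p else 1) := by
      intro i _
      by_cases hiA : i ∈ A
      · have hiB : i ∉ B := Finset.disjoint_left.mp hAB hiA
        simp [hiA, hiB]
      · by_cases hiB : i ∈ B <;> simp [hiA, hiB]
    rw [Finset.prod_congr rfl h2, Finset.prod_mul_distrib, Finset.prod_ite_mem,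
      Finset.prod_ite_mem, Finset.inter_eq_right.mpr hA, Finset.inter_eq_right.mpr hB]
    simp
  rw [← h1, h]
  refine Finset.sum_congr rfl fun R hR => ?_
  by_cases hBR : Disjoint B R
  · have e1 : ∏ i ∈ R, (if i ∈ B then (0 : ℝ) else p) = p ^ R.card := by
      rw [← Finset.prod_const]
      exact Finset.prod_congr rfl fun i hi => if_neg (Finset.disjoint_right.mp hBR hi)
    by_cases hAR : A ⊆ R
    · have e2 : ∏ i ∈ S \ R, (if i ∈ A then (0 : ℝ) else 1 - p) = (1 - p) ^ (S \ R).card := by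
        rw [← Finset.prod_const]
        exact Finset.prod_congr rfl fun i hi =>
          if_neg fun hi' => (Finset.mem_sdiff.mp hi).2 (hAR hi')
      rw [if_pos ⟨hAR, hBR⟩, e1, e2]
    · obtain ⟨i, hiA, hiR⟩ := Finset.not_subset.mp hAR
      have e2 : ∏ i ∈ S \ R, (if i ∈ A then (0 : ℝ) else 1 - p) = 0 :=
        Finset.prod_eq_zero (Finset.mem_sdiff.mpr ⟨hA hiA, hiR⟩) (if_pos hiA)
      rw [if_neg fun h => hAR h.1, e2, mul_zero]
  · obtain ⟨i, hiB, hiR⟩ := Finset.not_disjoint_iff.mp hBR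
    have e1 : ∏ i ∈ R, (if i ∈ B then (0 : ℝ) else p) = 0 :=
      Finset.prod_eq_zero hiR (if_pos hiB)
    rw [if_neg fun h => hBR h.2, e1, zero_mul]

theorem sum_powerset_weight {β : Type*} [DecidableEq β] (S : Finset β) (p : ℝ) :
    ∑ R ∈ S.powerset, p ^ R.card * (1 - p) ^ (S \ R).card = 1 := by
  simpa using sum_powerset_sampling (Finset.empty_subset S) (Finset.empty_subset S)
    (Finset.disjoint_empty_left _) p

/-- The expected size of a random sample. -/
theorem sum_powerset_weight_mul_card {β : Type*} [DecidableEq β] (S : Finset β) (p : ℝ) :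
    ∑ R ∈ S.powerset, p ^ R.card * (1 - p) ^ (S \ R).card * (R.card : ℝ) = p * S.card := by
  have h : ∀ R ∈ S.powerset, p ^ R.card * (1 - p) ^ (S \ R).card * (R.card : ℝ) =
      ∑ i ∈ S, if ({i} : Finset β) ⊆ R ∧ Disjoint ∅ R then
        p ^ R.card * (1 - p) ^ (S \ R).card else 0 := by
    intro R hR
    simp only [Finset.singleton_subset_iff, Finset.disjoint_empty_left, and_true]
    rw [Finset.sum_ite_mem, Finset.inter_eq_right.mpr (Finset.mem_powerset.mp hR),
      Finset.sum_const, nsmul_eq_mul, mul_comm]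
  rw [Finset.sum_congr rfl h, Finset.sum_comm]
  rw [Finset.sum_congr rfl fun i hi => sum_powerset_sampling (Finset.singleton_subset_iff.mpr hi)
    (Finset.empty_subset S) (Finset.disjoint_empty_right _) p]
  simp [mul_comm]

theorem one_add_pow_three_le_exp {u : ℝ} (hu : 0 ≤ u) :
    (u + 1) ^ 3 ≤ 13824 * Real.exp (u / 8) := by
  have h : u + 1 ≤ 24 * Real.exp (u / 24) := by
    have := Real.add_one_le_exp (u / 24)
    linarith
  calc (u + 1) ^ 3 ≤ (24 * Real.exp (u / 24)) ^ 3 := by gcongr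
    _ = 13824 * Real.exp (u / 8) := by
      rw [mul_pow, ← Real.exp_nat_mul]
      have : ((3 : ℕ) : ℝ) * (u / 24) = u / 8 := by push_cast; ring
      rw [this]
      norm_num

/-- Halving the sampling rate absorbs a cubic factor in the size of the conflict list. -/
theorem sampling_rate_halving {s t L : ℕ} (hs : 1 ≤ s) (ht : t ≤ 3) {p : ℝ}
    (hp : p = 1 / (4 * s)) :
    p ^ t * (1 - p) ^ L * ((L / s + 1 : ℕ) : ℝ) ^ 3 ≤
      110592 * ((p / 2) ^ t * (1 - p / 2) ^ L) := by
  have hs' : (1 : ℝ) ≤ s := by exact_mod_cast hs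
  have hp0 : 0 < p := by rw [hp]; positivity
  have hp1 : p ≤ 1 / 4 := by
    rw [hp]
    apply one_div_le_one_div_of_le <;> linarith
  have h1 : ((L / s + 1 : ℕ) : ℝ) ^ 3 ≤ 13824 * Real.exp (p / 2 * L) := by
    have : ((L / s + 1 : ℕ) : ℝ) ≤ (L : ℝ) / s + 1 := by
      push_cast
      gcongr
      exact Nat.cast_div_le
    calc ((L / s + 1 : ℕ) : ℝ) ^ 3 ≤ ((L : ℝ) / s + 1) ^ 3 := by gcongr
      _ ≤ 13824 * Real.exp ((L : ℝ) / s / 8) := one_add_pow_three_le_exp (by positivity)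
      _ = _ := by
        have : (L : ℝ) / s / 8 = p / 2 * L := by
          rw [hp]
          field_simp
          ring
        rw [this]
  -- One factor gives the half-rate weight; the other cancels the exponential, by `h3`.
  have h2 : (1 - p) ^ L ≤ (1 - p / 2) ^ L * (1 - p / 2) ^ L := by
    rw [← mul_pow]
    exact pow_le_pow_left₀ (by linarith) (by nlinarith) L
  have h3 : (1 - p / 2) ^ L * Real.exp (p / 2 * L) ≤ 1 := by
    have : 1 - p / 2 ≤ Real.exp (-(p / 2)) := by
      have := Real.add_one_le_exp (-(p / 2))
      linarith
    calc (1 - p / 2) ^ L * Real.exp (p / 2 * L)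
        ≤ Real.exp (-(p / 2)) ^ L * Real.exp (p / 2 * L) := by
          gcongr
          linarith
      _ = 1 := by
        rw [← Real.exp_nat_mul, ← Real.exp_add, ← Real.exp_zero]
        congr 1
        ring
  have h4 : p ^ t ≤ 8 * (p / 2) ^ t := by
    have h5 : p ^ t = 2 ^ t * (p / 2) ^ t := by rw [← mul_pow]; congr 1; ring
    have h6 : (2 : ℝ) ^ t ≤ 2 ^ 3 := pow_le_pow_right₀ (by norm_num) ht
    rw [h5]
    have : 0 ≤ (p / 2) ^ t := by positivity
    nlinarith
  have hq : 0 ≤ 1 - p / 2 := by linarith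
  have hq' : 0 ≤ 1 - p := by linarith
  calc p ^ t * (1 - p) ^ L * ((L / s + 1 : ℕ) : ℝ) ^ 3
      ≤ (8 * (p / 2) ^ t) * ((1 - p / 2) ^ L * (1 - p / 2) ^ L) *
        (13824 * Real.exp (p / 2 * L)) := by gcongr
    _ = 110592 * ((p / 2) ^ t * (1 - p / 2) ^ L) * ((1 - p / 2) ^ L * Real.exp (p / 2 * L)) := by
      ring
    _ ≤ 110592 * ((p / 2) ^ t * (1 - p / 2) ^ L) * 1 := by gcongr
    _ = _ := mul_one _

/-- Bernoulli's inequality for half of the exponent gives 1/2; then square. This is the chance that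
a neighbourhood of size `4 * s` avoids the sample. -/
theorem quarter_le_one_sub_pow {s : ℕ} (hs : 1 ≤ s) :
    (1 / 4 : ℝ) ≤ (1 - 1 / (4 * s)) ^ (4 * s) := by
  have hs' : (1 : ℝ) ≤ s := by exact_mod_cast hs
  have h0 : (1 : ℝ) / (4 * s) ≤ 1 := by
    rw [div_le_one (by positivity)]
    linarith
  have h := one_add_mul_le_pow (a := -(1 / (4 * s) : ℝ)) (by linarith) (2 * s)
  have h1 : (1 : ℝ) + ((2 * s : ℕ) : ℝ) * -(1 / (4 * s)) = 1 / 2 := by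
    push_cast
    field_simp
    norm_num
  rw [h1, ← sub_eq_add_neg] at h
  calc (1 / 4 : ℝ) = (1 / 2) ^ 2 := by norm_num
    _ ≤ ((1 - 1 / (4 * s)) ^ (2 * s)) ^ 2 := by gcongr
    _ = _ := by rw [← pow_mul]; congr 1; ring

/-- A Clarkson–Shor type bound. The objects `τ ∈ 𝒯` have at most three definers `A τ` and a conflict
list `B τ`; if every sample `R` has few active objects, and the points whose neighbourhoods of size
`4 * s` avoid `R` are covered by its active objects, then there are few points. -/
theorem card_le_of_sampling {α β γ : Type*} [DecidableEq β] (S : Finset β) (X : Finset α)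
    (N : α → Finset β) (𝒯 : Finset γ) (A B : γ → Finset β) {k s e : ℕ} (hs : 1 ≤ s)
    (hN : ∀ a ∈ X, N a ⊆ S ∧ (N a).card = 4 * s)
    (hT : ∀ τ ∈ 𝒯, A τ ⊆ S ∧ B τ ⊆ S ∧ Disjoint (A τ) (B τ) ∧ (A τ).card ≤ 3)
    (hcard : ∀ R ⊆ S, (𝒯.filter fun τ => A τ ⊆ R ∧ Disjoint (B τ) R).card ≤ 2 * (R.card + e))
    (hcover : ∀ R ⊆ S, (X.filter fun a => Disjoint (N a) R).card ≤
      ∑ τ ∈ 𝒯.filter (fun τ => A τ ⊆ R ∧ Disjoint (B τ) R), k * ((B τ).card / s + 1) ^ 3) :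
    (X.card : ℝ) ≤ 442368 * k * (S.card / (4 * s) + 2 * e) := by
  set p : ℝ := 1 / (4 * s) with hp
  have hs' : (1 : ℝ) ≤ s := by exact_mod_cast hs
  have hp0 : 0 < p := by positivity
  have hp1 : p ≤ 1 / 4 := by
    rw [hp]
    apply one_div_le_one_div_of_le <;> linarith
  have hw : ∀ q : ℝ, 0 ≤ q → q ≤ 1 → ∀ R : Finset β, 0 ≤ q ^ R.card * (1 - q) ^ (S \ R).card := by
    intro q h0 h1 R
    have : 0 ≤ 1 - q := by linarith
    positivity
  have swap : ∀ (q : ℝ) (c : γ → ℝ),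
      ∑ R ∈ S.powerset, q ^ R.card * (1 - q) ^ (S \ R).card *
        (∑ τ ∈ 𝒯.filter (fun τ => A τ ⊆ R ∧ Disjoint (B τ) R), c τ) =
      ∑ τ ∈ 𝒯, q ^ (A τ).card * (1 - q) ^ (B τ).card * c τ := by
    intro q c
    simp only [Finset.sum_filter, Finset.mul_sum]
    rw [Finset.sum_comm]
    refine Finset.sum_congr rfl fun τ hτ => ?_
    obtain ⟨h1, h2, h3, -⟩ := hT τ hτ
    rw [← sum_powerset_sampling h1 h2 h3 q, Finset.sum_mul]
    refine Finset.sum_congr rfl fun R _ => ?_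
    split_ifs <;> simp
  have lower : (X.card : ℝ) / 4 ≤ ∑ R ∈ S.powerset, p ^ R.card * (1 - p) ^ (S \ R).card *
      ((X.filter fun a => Disjoint (N a) R).card : ℝ) := by
    have h1 : ∀ R ∈ S.powerset, p ^ R.card * (1 - p) ^ (S \ R).card *
        ((X.filter fun a => Disjoint (N a) R).card : ℝ) =
        ∑ a ∈ X, if ∅ ⊆ R ∧ Disjoint (N a) R then
          p ^ R.card * (1 - p) ^ (S \ R).card else 0 := by
      intro R _
      simp only [Finset.empty_subset, true_and]
      rw [← Finset.sum_filter, Finset.sum_const, nsmul_eq_mul, mul_comm]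
    rw [Finset.sum_congr rfl h1, Finset.sum_comm, Finset.sum_congr rfl fun a ha =>
      sum_powerset_sampling (Finset.empty_subset S) (hN a ha).1 (Finset.disjoint_empty_left _) p]
    have h2 : ∀ a ∈ X, (1 / 4 : ℝ) ≤ p ^ (∅ : Finset β).card * (1 - p) ^ (N a).card := by
      intro a ha
      rw [(hN a ha).2, Finset.card_empty, pow_zero, one_mul]
      exact quarter_le_one_sub_pow hs
    calc (X.card : ℝ) / 4 = ∑ a ∈ X, (1 / 4 : ℝ) := by simp [div_eq_mul_inv]
      _ ≤ _ := Finset.sum_le_sum h2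
  -- The left side is the expected number of active objects at rate `p / 2`.
  have upper : ∑ τ ∈ 𝒯, (p / 2) ^ (A τ).card * (1 - p / 2) ^ (B τ).card * (1 : ℝ) ≤
      p * S.card + 2 * e := by
    rw [← swap (p / 2) fun _ => 1]
    calc _ ≤ ∑ R ∈ S.powerset, (p / 2) ^ R.card * (1 - p / 2) ^ (S \ R).card *
          (2 * (R.card + e)) := by
          refine Finset.sum_le_sum fun R hR => ?_
          refine mul_le_mul_of_nonneg_left ?_ (hw _ (by linarith) (by linarith) R)
          simp only [Finset.sum_const, nsmul_eq_mul, mul_one]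
          exact_mod_cast hcard R (Finset.mem_powerset.mp hR)
      _ = 2 * (∑ R ∈ S.powerset, (p / 2) ^ R.card * (1 - p / 2) ^ (S \ R).card * (R.card : ℝ)) +
          2 * e * ∑ R ∈ S.powerset, (p / 2) ^ R.card * (1 - p / 2) ^ (S \ R).card := by
        rw [Finset.mul_sum, Finset.mul_sum, ← Finset.sum_add_distrib]
        exact Finset.sum_congr rfl fun R _ => by ring
      _ = p * S.card + 2 * e := by
        rw [sum_powerset_weight, sum_powerset_weight_mul_card]
        ring
  have key : (X.card : ℝ) / 4 ≤ 110592 * k * (p * S.card + 2 * e) := by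
    calc (X.card : ℝ) / 4 ≤ _ := lower
      _ ≤ ∑ R ∈ S.powerset, p ^ R.card * (1 - p) ^ (S \ R).card *
          (∑ τ ∈ 𝒯.filter (fun τ => A τ ⊆ R ∧ Disjoint (B τ) R),
            (k : ℝ) * (((B τ).card / s + 1 : ℕ) : ℝ) ^ 3) := by
        refine Finset.sum_le_sum fun R hR => ?_
        refine mul_le_mul_of_nonneg_left ?_ (hw _ (by linarith) (by linarith) R)
        exact_mod_cast hcover R (Finset.mem_powerset.mp hR)
      _ = ∑ τ ∈ 𝒯, p ^ (A τ).card * (1 - p) ^ (B τ).card *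
          ((k : ℝ) * (((B τ).card / s + 1 : ℕ) : ℝ) ^ 3) := swap p _
      _ ≤ ∑ τ ∈ 𝒯, 110592 * k * ((p / 2) ^ (A τ).card * (1 - p / 2) ^ (B τ).card * 1) := by
        refine Finset.sum_le_sum fun τ hτ => ?_
        have := mul_le_mul_of_nonneg_left
          (sampling_rate_halving (L := (B τ).card) hs (hT τ hτ).2.2.2 hp) (Nat.cast_nonneg (α := ℝ) k)
        linarith
      _ = 110592 * k * ∑ τ ∈ 𝒯, (p / 2) ^ (A τ).card * (1 - p / 2) ^ (B τ).card * (1 : ℝ) := by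
        rw [Finset.mul_sum]
      _ ≤ _ := by gcongr
  have : (S.card : ℝ) / (4 * s) = p * S.card := by rw [hp]; ring
  rw [this]
  linarith

/-! ### Staircases and their corners. -/

/-- The points of a family lying strictly above the corner `(f a 0, f b 1, f c 2)`. -/
def cornerConflicts {β T : Type*} [Fintype β] [LinearOrder T] (f : β → Fin 3 → T)
    (τ : β × β × β) : Finset β :=
  Finset.univ.filter fun q => f τ.1 0 < f q 0 ∧ f τ.2.1 1 < f q 1 ∧ f τ.2.2 2 < f q 2

/-- `(a, b, c)` spans a corner of a three-dimensional staircase: each member bounds it in one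
coordinate and lies beyond it in the other two. -/
def IsStaircaseCorner {β T : Type*} [LinearOrder T] (f : β → Fin 3 → T) (τ : β × β × β) : Prop :=
  (f τ.1 0 < f τ.2.1 0 ∧ f τ.1 0 < f τ.2.2 0) ∧ (f τ.2.1 1 < f τ.1 1 ∧ f τ.2.1 1 < f τ.2.2 1) ∧
    (f τ.2.2 2 < f τ.1 2 ∧ f τ.2.2 2 < f τ.2.1 2)

section Corners

variable {β T : Type*} [Fintype β] [LinearOrder T] {f : β → Fin 3 → T}

/-- A staircase spanned by `R` has at most `2 * #R` corners. -/
theorem card_corners_le (hf : ∀ i, Function.Injective fun b => f b i) (R : Finset β)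
    (U : Finset (β × β × β))
    (hU : ∀ τ ∈ U, IsStaircaseCorner f τ ∧ τ.1 ∈ R ∧ τ.2.1 ∈ R ∧ τ.2.2 ∈ R ∧
      Disjoint (cornerConflicts f τ) R) :
    U.card ≤ 2 * R.card := by
  have hempty : ∀ τ ∈ U, ∀ q ∈ R, f τ.1 0 < f q 0 → f τ.2.1 1 < f q 1 → f q 2 ≤ f τ.2.2 2 := by
    intro τ hτ q hq h0 h1
    by_contra! h2
    exact Finset.disjoint_left.mp (hU τ hτ).2.2.2.2
      (by simp only [cornerConflicts, Finset.mem_filter, Finset.mem_univ, true_and]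
          exact ⟨h0, h1, h2⟩) hq
  -- Emptiness makes the third member the highest one beyond the first two, so the pair determines
  -- the corner.
  have third : ∀ τ ∈ U, ∀ σ ∈ U, τ.1 = σ.1 → τ.2.1 = σ.2.1 → τ = σ := by
    intro τ hτ σ hσ e1 e2
    obtain ⟨⟨⟨-, h1⟩, ⟨-, h2⟩, -⟩, -, -, h3, -⟩ := hU τ hτ
    obtain ⟨⟨⟨-, g1⟩, ⟨-, g2⟩, -⟩, -, -, g3, -⟩ := hU σ hσ
    have e3 : τ.2.2 = σ.2.2 := hf 2 (le_antisymm
      (hempty σ hσ _ h3 (e1 ▸ h1) (e2 ▸ h2)) (hempty τ hτ _ g3 (e1 ▸ g1) (e2 ▸ g2)))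
    exact Prod.ext e1 (Prod.ext e2 e3)
  -- Charge a corner to whichever of its first two members is lower in coordinate 2. For a fixed
  -- charged member, a competitor for the other place would lie above the other corner in all three
  -- coordinates.
  rw [← Finset.card_filter_add_card_filter_not (s := U) (fun τ => f τ.1 2 < f τ.2.1 2), two_mul]
  refine Nat.add_le_add ?_ ?_
  · refine Finset.card_le_card_of_injOn (fun τ => τ.1)
      (fun τ hτ => (hU τ (Finset.mem_filter.mp hτ).1).2.1) ?_
    intro τ hτ σ hσ e
    obtain ⟨hτ, hτ'⟩ := Finset.mem_filter.mp (Finset.mem_coe.mp hτ)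
    obtain ⟨hσ, hσ'⟩ := Finset.mem_filter.mp (Finset.mem_coe.mp hσ)
    have e : τ.1 = σ.1 := e
    have aux : ∀ τ ∈ U, ∀ σ ∈ U, τ.1 = σ.1 → f τ.1 2 < f τ.2.1 2 → f τ.2.1 1 ≤ f σ.2.1 1 := by
      intro τ hτ σ hσ e h
      by_contra! h1
      obtain ⟨⟨⟨h2, -⟩, -, -⟩, -, h3, -⟩ := hU τ hτ
      obtain ⟨⟨-, -, ⟨g2, -⟩⟩, -⟩ := hU σ hσ
      have := hempty σ hσ _ h3 (e ▸ h2) h1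
      rw [e] at h
      exact absurd (g2.trans h) this.not_gt
    exact third τ hτ σ hσ e (hf 1 (le_antisymm (aux τ hτ σ hσ e hτ') (aux σ hσ τ hτ e.symm hσ')))
  · refine Finset.card_le_card_of_injOn (fun τ => τ.2.1)
      (fun τ hτ => (hU τ (Finset.mem_filter.mp hτ).1).2.2.1) ?_
    intro τ hτ σ hσ e
    obtain ⟨hτ, hτ'⟩ := Finset.mem_filter.mp (Finset.mem_coe.mp hτ)
    obtain ⟨hσ, hσ'⟩ := Finset.mem_filter.mp (Finset.mem_coe.mp hσ)
    have e : τ.2.1 = σ.2.1 := e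
    have aux : ∀ τ ∈ U, ∀ σ ∈ U, τ.2.1 = σ.2.1 → ¬ f τ.1 2 < f τ.2.1 2 → f τ.1 0 ≤ f σ.1 0 := by
      intro τ hτ σ hσ e h
      by_contra! h1
      obtain ⟨⟨-, ⟨h2, -⟩, -⟩, h3, -⟩ := hU τ hτ
      obtain ⟨⟨-, -, ⟨-, g2⟩⟩, -⟩ := hU σ hσ
      have := hempty σ hσ _ h3 h1 (e ▸ h2)
      rw [e] at h
      exact absurd (g2.trans_le (not_lt.mp h)) this.not_gt
    exact third τ hτ σ hσ (hf 0 (le_antisymm (aux τ hτ σ hσ e hτ') (aux σ hσ τ hτ e.symm hσ'))) e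

/-- A point with no member of `R` above it lies above a corner of the staircase spanned by `R`,
provided that `R` is unbounded in the three coordinate directions relative to the point. -/
theorem exists_corner_le (R : Finset β) (x : Fin 3 → T) (d : Fin 3 → β) (hd : ∀ i, d i ∈ R)
    (hd' : ∀ i j, i ≠ j → x j < f (d i) j)
    (hx : ∀ q ∈ R, ¬ ∀ i, x i < f q i) :
    ∃ τ : β × β × β, IsStaircaseCorner f τ ∧ τ.1 ∈ R ∧ τ.2.1 ∈ R ∧ τ.2.2 ∈ R ∧
      Disjoint (cornerConflicts f τ) R ∧ f τ.1 0 ≤ x 0 ∧ f τ.2.1 1 ≤ x 1 ∧ f τ.2.2 2 ≤ x 2 := by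
  have hx' : ∀ q ∈ R, x 1 < f q 1 → x 2 < f q 2 → f q 0 ≤ x 0 := by
    intro q hq h1 h2
    by_contra! h0
    refine hx q hq fun i => ?_
    fin_cases i <;> assumption
  -- Slide the point down in one coordinate at a time until a member of `R` blocks it; the members
  -- `d i` ensure that a blocker exists.
  obtain ⟨a, ha, hamax⟩ := Finset.exists_max_image (R.filter fun q => x 1 < f q 1 ∧ x 2 < f q 2)
    (fun q => f q 0) ⟨d 0, Finset.mem_filter.mpr
      ⟨hd 0, hd' 0 1 (by decide), hd' 0 2 (by decide)⟩⟩
  obtain ⟨haR, ha1, ha2⟩ := Finset.mem_filter.mp ha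
  have ha0 := hx' a haR ha1 ha2
  obtain ⟨b, hb, hbmax⟩ := Finset.exists_max_image (R.filter fun q => f a 0 < f q 0 ∧ x 2 < f q 2)
    (fun q => f q 1) ⟨d 1, Finset.mem_filter.mpr
      ⟨hd 1, ha0.trans_lt (hd' 1 0 (by decide)), hd' 1 2 (by decide)⟩⟩
  obtain ⟨hbR, hb0, hb2⟩ := Finset.mem_filter.mp hb
  have hb1 : f b 1 ≤ x 1 := by
    by_contra! h
    exact absurd hb0 (hamax b (Finset.mem_filter.mpr ⟨hbR, h, hb2⟩)).not_gt
  obtain ⟨c, hc, hcmax⟩ := Finset.exists_max_image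
    (R.filter fun q => f a 0 < f q 0 ∧ f b 1 < f q 1) (fun q => f q 2) ⟨d 2, Finset.mem_filter.mpr
      ⟨hd 2, ha0.trans_lt (hd' 2 0 (by decide)), hb1.trans_lt (hd' 2 1 (by decide))⟩⟩
  obtain ⟨hcR, hc0, hc1⟩ := Finset.mem_filter.mp hc
  have hc2 : f c 2 ≤ x 2 := by
    by_contra! h
    exact absurd hc1 (hbmax c (Finset.mem_filter.mpr ⟨hcR, hc0, h⟩)).not_gt
  refine ⟨(a, b, c), ⟨⟨hb0, hc0⟩, ⟨hb1.trans_lt ha1, hc1⟩, hc2.trans_lt ha2, hc2.trans_lt hb2⟩,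
    haR, hbR, hcR, ?_, ha0, hb1, hc2⟩
  refine Finset.disjoint_left.mpr fun q hq hqR => ?_
  simp only [cornerConflicts, Finset.mem_filter, Finset.mem_univ, true_and] at hq
  exact absurd hq.2.2 (hcmax q (Finset.mem_filter.mpr ⟨hqR, hq.1, hq.2.1⟩)).not_gt

/-- Points whose large neighbourhoods all lie in a common conflict list `V` are few, if no `k` of
them have `k` common neighbours. -/
theorem card_le_of_common_conflicts {α : Type*} (x : α → Fin 3 → T) (X : Finset α)
    (V : Finset β) {k s : ℕ} (hs : 1 ≤ s) (hks : k ≤ s)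
    (hX : ∀ a ∈ X, (Finset.univ.filter fun b => ∀ i, x a i < f b i) ⊆ V ∧
      (Finset.univ.filter fun b => ∀ i, x a i < f b i).card = 4 * s)
    (hfree : ∀ Y ⊆ X, ∀ W : Finset β, (∀ a ∈ Y, ∀ b ∈ W, ∀ i, x a i < f b i) →
      k ≤ Y.card → W.card < k) :
    X.card ≤ k * (V.card / s + 1) ^ 3 := by
  classical
  -- Ranks within `V`, grouped into blocks of length `s`, give a grid in which each cell holds at
  -- most `k` points.
  let r : α → Fin 3 → ℕ := fun a i => (V.filter fun b => x a i < f b i).card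
  have hr : ∀ a i, r a i / s < V.card / s + 1 := fun a i =>
    Nat.lt_succ_of_le (Nat.div_le_div_right (Finset.card_filter_le _ _))
  let g : α → Fin 3 → Fin (V.card / s + 1) := fun a i => ⟨r a i / s, hr a i⟩
  have hcl : ∀ γ ∈ (Finset.univ : Finset (Fin 3 → Fin (V.card / s + 1))),
      (X.filter fun a => g a = γ).card ≤ k := by
    intro γ _
    by_contra! hlt
    set Y := X.filter fun a => g a = γ with hY
    have hne : Y.Nonempty := Finset.card_pos.mp (by omega)
    choose m hmY hm using fun i => Finset.exists_max_image Y (fun a => x a i) hne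
    obtain ⟨a₀, ha₀⟩ := hne
    have hYX : Y ⊆ X := Finset.filter_subset _ _
    set W := V.filter fun b => ∀ i, x (m i) i < f b i with hW
    have hWk : W.card < k := by
      refine hfree Y hYX W (fun a ha b hb i => ?_) hlt.le
      exact (hm i a ha).trans_lt ((Finset.mem_filter.mp hb).2 i)
    -- A neighbour of `a₀` either contains the whole cell or lies in a slab of at most `s` regions
    -- per coordinate, so `4 * s < k + 3 * s`, against `k ≤ s`.
    have hsub : (Finset.univ.filter fun b => ∀ i, x a₀ i < f b i) ⊆
        W ∪ Finset.univ.biUnion fun i => (V.filter fun b => x a₀ i < f b i) \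
          (V.filter fun b => x (m i) i < f b i) := by
      intro b hb
      have hbV := (hX a₀ (hYX ha₀)).1 hb
      have hb' := (Finset.mem_filter.mp hb).2
      by_cases h : ∀ i, x (m i) i < f b i
      · exact Finset.mem_union_left _ (Finset.mem_filter.mpr ⟨hbV, h⟩)
      · push Not at h
        obtain ⟨i, hi⟩ := h
        refine Finset.mem_union_right _ (Finset.mem_biUnion.mpr ⟨i, Finset.mem_univ _, ?_⟩)
        rw [Finset.mem_sdiff, Finset.mem_filter, Finset.mem_filter]
        exact ⟨⟨hbV, hb' i⟩, fun h' => absurd h'.2 hi.not_gt⟩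
    have hslab : ∀ i ∈ (Finset.univ : Finset (Fin 3)), ((V.filter fun b => x a₀ i < f b i) \
          (V.filter fun b => x (m i) i < f b i)).card ≤ s := by
      intro i _
      rw [Finset.card_sdiff_of_subset]
      · have h1 : r a₀ i / s = r (m i) i / s := by
          have e1 := (Finset.mem_filter.mp ha₀).2
          have e2 := (Finset.mem_filter.mp (hmY i)).2
          exact congrArg Fin.val (congrFun (e1.trans e2.symm) i)
        have h2 := Nat.div_add_mod (r a₀ i) s
        have h3 := Nat.div_add_mod (r (m i) i) s
        have h4 := Nat.mod_lt (r a₀ i) (show 0 < s by omega)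
        rw [h1] at h2
        change r a₀ i - r (m i) i ≤ s
        omega
      · intro b hb
        rw [Finset.mem_filter] at hb ⊢
        exact ⟨hb.1, (hm i a₀ ha₀).trans_lt hb.2⟩
    have h5 := Finset.card_le_card hsub
    rw [(hX a₀ (hYX ha₀)).2] at h5
    have h6 := Finset.card_union_le W (Finset.univ.biUnion fun i =>
      (V.filter fun b => x a₀ i < f b i) \ (V.filter fun b => x (m i) i < f b i))
    have h7 := Finset.card_biUnion_le_card_mul Finset.univ _ s hslab
    simp only [Finset.card_univ, Fintype.card_fin] at h7
    omega
  have := Finset.card_le_mul_card_image_of_maps_to (f := g) (s := X) (t := Finset.univ)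
    (fun a _ => Finset.mem_univ _) k hcl
  simpa using this

end Corners

/-! ### A point of small degree. -/

/-- Points with neighbourhoods of size `4 * s` in three-dimensional dominance, under the exclusion
of `K_{k,k}`. The regions `d i` bound the staircases in the three coordinate directions. -/
theorem card_le_of_degree_eq {α β T : Type*} [Fintype β] [DecidableEq β] [LinearOrder T]
    {f : β → Fin 3 → T} (hf : ∀ i, Function.Injective fun b => f b i) (x : α → Fin 3 → T)
    (X : Finset α) (d : Fin 3 → β) (hd : ∀ a ∈ X, ∀ i j, i ≠ j → x a j < f (d i) j)
    (hd' : ∀ a ∈ X, ∀ i, f (d i) i ≤ x a i) {k s : ℕ} (hs : 1 ≤ s) (hks : k ≤ s)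
    (hX : ∀ a ∈ X, (Finset.univ.filter fun b => ∀ i, x a i < f b i).card = 4 * s)
    (hfree : ∀ Y ⊆ X, ∀ W : Finset β, (∀ a ∈ Y, ∀ b ∈ W, ∀ i, x a i < f b i) →
      k ≤ Y.card → W.card < k) :
    (X.card : ℝ) ≤ 442368 * k * (Fintype.card β / (4 * s) + 6) := by
  classical
  -- The bounding regions join every sample: only the others are drawn, and `E` is removed from the
  -- definers. It adds at most 3 to the sample size, hence `e := 3`.
  set E : Finset β := Finset.univ.image d with hE
  have hE3 : E.card ≤ 3 := Finset.card_image_le.trans (by simp)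
  have hdE : ∀ i, d i ∈ E := fun i => Finset.mem_image_of_mem _ (Finset.mem_univ i)
  set N : α → Finset β := fun a => Finset.univ.filter fun b => ∀ i, x a i < f b i with hN
  have hNE : ∀ a ∈ X, Disjoint (N a) E := by
    intro a ha
    refine Finset.disjoint_right.mpr fun b hb hb' => ?_
    obtain ⟨i, -, rfl⟩ := Finset.mem_image.mp hb
    exact absurd ((Finset.mem_filter.mp hb').2 i) (hd' a ha i).not_gt
  have hsdiff : ∀ {V : Finset β}, Disjoint V E → V ⊆ Finset.univ \ E := fun h =>
    Finset.subset_sdiff.mpr ⟨Finset.subset_univ _, h⟩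
  have main := card_le_of_sampling (Finset.univ \ E) X N
    (Finset.univ.filter fun τ => IsStaircaseCorner f τ ∧ Disjoint (cornerConflicts f τ) E)
    (fun τ => ({τ.1, τ.2.1, τ.2.2} : Finset β) \ E) (cornerConflicts f) (k := k) (s := s) (e := 3)
    hs (fun a ha => ⟨hsdiff (hNE a ha), hX a ha⟩) ?_ ?_ ?_
  · refine main.trans ?_
    have h1 : ((Finset.univ \ E).card : ℝ) ≤ Fintype.card β := by
      exact_mod_cast Finset.card_le_univ _
    have h2 : (2 : ℝ) * ((3 : ℕ) : ℝ) = 6 := by norm_num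
    rw [h2]
    gcongr
  · intro τ hτ
    obtain ⟨-, -, hτE⟩ := Finset.mem_filter.mp hτ
    refine ⟨Finset.sdiff_subset_sdiff (Finset.subset_univ _) le_rfl, hsdiff hτE, ?_,
      (Finset.card_le_card Finset.sdiff_subset).trans Finset.card_le_three⟩
    refine Finset.disjoint_left.mpr fun b hb hb' => ?_
    obtain ⟨-, h0, h1, h2⟩ := Finset.mem_filter.mp hb'
    have := (Finset.mem_sdiff.mp hb).1
    simp only [Finset.mem_insert, Finset.mem_singleton] at this
    rcases this with rfl | rfl | rfl
    · exact lt_irrefl _ h0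
    · exact lt_irrefl _ h1
    · exact lt_irrefl _ h2
  · intro R _
    refine (card_corners_le hf (R ∪ E) _ fun τ hτ => ?_).trans
      (Nat.mul_le_mul_left 2 ((Finset.card_union_le R E).trans (Nat.add_le_add_left hE3 _)))
    obtain ⟨hτ, hAR, hBR⟩ := Finset.mem_filter.mp hτ
    obtain ⟨-, hc, hτE⟩ := Finset.mem_filter.mp hτ
    have hsub : ({τ.1, τ.2.1, τ.2.2} : Finset β) ⊆ R ∪ E := by
      rw [Finset.union_comm]
      exact sdiff_le_iff.mp hAR
    exact ⟨hc, hsub (by simp), hsub (by simp), hsub (by simp),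
      Finset.disjoint_union_right.mpr ⟨hBR, hτE⟩⟩
  · intro R _
    have hsub : (X.filter fun a => Disjoint (N a) R) ⊆
        ((Finset.univ.filter fun τ => IsStaircaseCorner f τ ∧ Disjoint (cornerConflicts f τ) E).filter
          fun τ => ({τ.1, τ.2.1, τ.2.2} : Finset β) \ E ⊆ R ∧
            Disjoint (cornerConflicts f τ) R).biUnion
          fun τ => X.filter fun a => f τ.1 0 ≤ x a 0 ∧ f τ.2.1 1 ≤ x a 1 ∧ f τ.2.2 2 ≤ x a 2 := by
      intro a ha
      obtain ⟨ha, hdis⟩ := Finset.mem_filter.mp ha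
      obtain ⟨τ, hc, h0, h1, h2, hR, hle⟩ := exists_corner_le (f := f) (R ∪ E) (x a) d
        (fun i => Finset.mem_union_right _ (hdE i)) (hd a ha) (fun q hq hlt =>
          Finset.disjoint_left.mp (Finset.disjoint_union_right.mpr ⟨hdis, hNE a ha⟩)
            (Finset.mem_filter.mpr ⟨Finset.mem_univ q, hlt⟩) hq)
      obtain ⟨hR1, hR2⟩ := Finset.disjoint_union_right.mp hR
      refine Finset.mem_biUnion.mpr ⟨τ, Finset.mem_filter.mpr ⟨Finset.mem_filter.mpr
        ⟨Finset.mem_univ _, hc, hR2⟩, ?_, hR1⟩, Finset.mem_filter.mpr ⟨ha, hle⟩⟩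
      rw [Finset.union_comm] at h0 h1 h2
      refine sdiff_le_iff.mpr ?_
      simp only [Finset.sup_eq_union, Finset.insert_subset_iff, Finset.singleton_subset_iff]
      exact ⟨h0, h1, h2⟩
    refine (Finset.card_le_card hsub).trans (Finset.card_biUnion_le.trans
      (Finset.sum_le_sum fun τ _ => ?_))
    refine card_le_of_common_conflicts x _ (cornerConflicts f τ) hs hks (fun a ha => ?_)
      fun Y hY => hfree Y (hY.trans (Finset.filter_subset _ _))
    obtain ⟨ha, h0, h1, h2⟩ := Finset.mem_filter.mp ha
    refine ⟨fun b hb => ?_, hX a ha⟩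
    have hb := (Finset.mem_filter.mp hb).2
    exact Finset.mem_filter.mpr ⟨Finset.mem_univ _, h0.trans_lt (hb 0), h1.trans_lt (hb 1),
      h2.trans_lt (hb 2)⟩

/-- A point of large degree can be raised in the first coordinate to have a prescribed degree. -/
theorem exists_update_card_eq {β T : Type*} [Fintype β] [LinearOrder T]
    {f : β → Fin 3 → T} (hf : Function.Injective fun b => f b 0) (D n : ℕ) (x : Fin 3 → T)
    (hx : (Finset.univ.filter fun b => ∀ i, x i < f b i).card = D + n) :
    ∃ t, x 0 ≤ t ∧ (t = x 0 ∨ ∃ b, (∀ i, x i < f b i) ∧ t = f b 0) ∧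
      (Finset.univ.filter fun b => ∀ i, Function.update x 0 t i < f b i).card = D := by
  classical
  induction n generalizing x with
  | zero => exact ⟨x 0, le_rfl, Or.inl rfl, by simpa using hx⟩
  | succ n ih =>
    -- Raising to the lowest first coordinate among the neighbours loses only `b`, by injectivity.
    obtain ⟨b, hb, hmin⟩ := Finset.exists_min_image
      (Finset.univ.filter fun b => ∀ i, x i < f b i) (fun b => f b 0)
      (Finset.card_pos.mp (by omega))
    have hb' := (Finset.mem_filter.mp hb).2
    have herase : (Finset.univ.filter fun c => ∀ i, Function.update x 0 (f b 0) i < f c i) =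
        (Finset.univ.filter fun b => ∀ i, x i < f b i).erase b := by
      ext c
      simp only [Finset.mem_filter, Finset.mem_univ, true_and, Finset.mem_erase,
        Fin.forall_fin_succ, Function.update_self]
      constructor
      · rintro ⟨h0, h1⟩
        refine ⟨fun h => lt_irrefl _ (h ▸ h0), (hb' 0).trans h0, ?_⟩
        simpa using h1
      · rintro ⟨hne, h0, h1⟩
        refine ⟨lt_of_le_of_ne (hmin c ?_) fun h => hne (hf h).symm, by simpa using h1⟩
        simp only [Finset.mem_filter, Finset.mem_univ, true_and, Fin.forall_fin_succ]
        exact ⟨h0, h1⟩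
    obtain ⟨t, ht, ht', hcard⟩ := ih (Function.update x 0 (f b 0)) (by
      rw [herase, Finset.card_erase_of_mem hb]
      omega)
    rw [Function.update_self] at ht ht'
    rw [Function.update_idem] at hcard
    refine ⟨t, (hb' 0).le.trans ht, Or.inr ?_, hcard⟩
    rcases ht' with rfl | ⟨c, hc, rfl⟩
    · exact ⟨b, hb', rfl⟩
    · refine ⟨c, ?_, rfl⟩
      have : c ∈ (Finset.univ.filter fun b => ∀ i, x i < f b i).erase b := by
        rw [← herase]
        simpa using hc
      exact (Finset.mem_filter.mp (Finset.mem_of_mem_erase this)).2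

open Classical in
/-- If there are at least as many points as regions and no `K_{k,k}`, then some point lies in only
`O(k)` regions. -/
theorem exists_dominance_degree_lt {α β : Type*} (A : Finset α) (B : Finset β)
    (x : α → Fin 3 → ℝ) (y : β → Fin 3 → ℝ) {k : ℕ} (hk : 1 ≤ k) (hA : A.Nonempty)
    (hBA : B.card ≤ A.card)
    (hfree : ∀ Y ⊆ A, ∀ W ⊆ B, (∀ a ∈ Y, ∀ b ∈ W, x a ≤ y b) → k ≤ Y.card → W.card < k) :
    ∃ a ∈ A, (B.filter fun b => x a ≤ y b).card < 4 * (1000000 * k) := by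
  classical
  by_contra! hdeg
  set s := 1000000 * k with hs
  obtain ⟨M, hMx, hMy⟩ : ∃ M : ℝ, (∀ a ∈ A, ∀ i, |x a i| < M) ∧ ∀ b ∈ B, ∀ i, |y b i| < M := by
    obtain ⟨M, hM⟩ := ((A ×ˢ Finset.univ).image (fun p : α × Fin 3 => |x p.1 p.2|) ∪
      (B ×ˢ Finset.univ).image (fun p : β × Fin 3 => |y p.1 p.2|)).exists_le
    refine ⟨M + 1, fun a ha i => ?_, fun b hb i => ?_⟩
    · refine lt_of_le_of_lt (hM _ (Finset.mem_union_left _ (Finset.mem_image.mpr ⟨(a, i), ?_, rfl⟩)))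
        (lt_add_one M)
      simpa using ha
    · refine lt_of_le_of_lt (hM _ (Finset.mem_union_right _ (Finset.mem_image.mpr
        ⟨(b, i), ?_, rfl⟩))) (lt_add_one M)
      simpa using hb
  let e := Fintype.equivFin (B ⊕ Fin 3)
  -- Dummy `j` is below all points in coordinate `j` and above them in the others, so it contains no
  -- point but bounds the staircase.
  let g : B ⊕ Fin 3 → Fin 3 → ℝ := fun b i =>
    Sum.elim (fun b : B => y b i) (fun j => if i = j then -M else M) b
  -- Lexicographic labels make the region coordinates distinct; label 0 for points and positive
  -- labels for regions turn `≤` into `<`.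
  let f : B ⊕ Fin 3 → Fin 3 → ℝ ×ₗ ℕ := fun b i => toLex (g b i, (e b : ℕ) + 1)
  let x' : α → Fin 3 → ℝ ×ₗ ℕ := fun a i => toLex (x a i, 0)
  have hlt : ∀ a b i, x' a i < f b i ↔ x a i ≤ g b i := by
    intro a b i
    simp only [x', f, Prod.Lex.toLex_lt_toLex, Nat.succ_pos, and_true]
    exact le_iff_lt_or_eq.symm
  have hf : ∀ i, Function.Injective fun b => f b i := by
    intro i b c h
    have h : (g b i, (e b : ℕ) + 1) = (g c i, (e c : ℕ) + 1) := toLex.injective h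
    have := (Prod.mk.inj h).2
    exact e.injective (Fin.ext (by omega))
  have hdummy : ∀ a ∈ A, ∀ j : Fin 3, f (Sum.inr j) j < x' a j := by
    intro a ha j
    have := (abs_lt.mp (hMx a ha j)).1
    exact Prod.Lex.toLex_lt_toLex.mpr (Or.inl (by simpa [g] using this))
  have hN : ∀ a ∈ A, (Finset.univ.filter fun b => ∀ i, x' a i < f b i).card =
      (B.filter fun b => x a ≤ y b).card := by
    intro a ha
    symm
    refine Finset.card_bij (fun b hb => Sum.inl ⟨b, (Finset.mem_filter.mp hb).1⟩) ?_ ?_ ?_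
    · intro b hb
      simp only [Finset.mem_filter, Finset.mem_univ, true_and]
      exact fun i => (hlt a _ i).mpr ((Finset.mem_filter.mp hb).2 i)
    · intro b _ c _ h
      exact congrArg Subtype.val (Sum.inl_injective h)
    · rintro (b | j) hb
      · have hb := (Finset.mem_filter.mp hb).2
        exact ⟨b, Finset.mem_filter.mpr ⟨b.2, fun i => (hlt a _ i).mp (hb i)⟩, rfl⟩
      · exact absurd ((Finset.mem_filter.mp hb).2 j) (hdummy a ha j).not_gt
  have hraise : ∀ a ∈ A, ∃ t, x' a 0 ≤ t ∧
      (t = x' a 0 ∨ ∃ b, (∀ i, x' a i < f b i) ∧ t = f b 0) ∧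
      (Finset.univ.filter fun b => ∀ i, Function.update (x' a) 0 t i < f b i).card = 4 * s := by
    intro a ha
    obtain ⟨n, hn⟩ := Nat.exists_eq_add_of_le ((hdeg a ha).trans_eq (hN a ha).symm)
    exact exists_update_card_eq (hf 0) _ n _ hn
  choose! t ht0 ht1 ht2 using hraise
  let z : α → Fin 3 → ℝ ×ₗ ℕ := fun a => Function.update (x' a) 0 (t a)
  have hxz : ∀ a ∈ A, ∀ i, x' a i ≤ z a i := by
    intro a ha i
    by_cases hi : i = 0
    · subst hi
      simpa [z] using ht0 a ha
    · simp [z, hi]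
  have hzd : ∀ a ∈ A, ∀ i j : Fin 3, i ≠ j → z a j < f (Sum.inr i) j := by
    intro a ha i j hij
    have hx : x' a j < f (Sum.inr i) j := by
      refine (hlt _ _ _).mpr ?_
      have := (abs_lt.mp (hMx a ha j)).2.le
      simpa [g, hij.symm] using this
    by_cases hj : j = 0
    · subst hj
      -- A raised coordinate is that of a neighbour, hence of a genuine region, and so stays below
      -- `M`.
      rcases ht1 a ha with h | ⟨b | l, hb, h⟩
      · simpa [z, h] using hx
      · simp only [z, Function.update_self, h]
        have := (abs_lt.mp (hMy b b.2 0)).2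
        exact Prod.Lex.toLex_lt_toLex.mpr (Or.inl (by simpa [g, hij.symm] using this))
      · exact absurd (hb l) (hdummy a ha l).not_gt
    · simpa [z, hj] using hx
  have hbound := card_le_of_degree_eq hf z A Sum.inr hzd
    (fun a ha i => (hdummy a ha i).le.trans (hxz a ha i)) (k := k) (s := s) (by omega) (by omega)
    ht2 (by
      intro Y hY W hYW hYk
      obtain ⟨a₀, ha₀⟩ : Y.Nonempty := Finset.card_pos.mp (by omega)
      have hrel : ∀ a ∈ Y, ∀ b ∈ W, ∀ i, x' a i < f b i := fun a ha b hb i =>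
        (hxz a (hY ha) i).trans_lt (hYW a ha b hb i)
      have hright : W.toRight = ∅ := by
        refine Finset.eq_empty_of_forall_notMem fun j hj => ?_
        exact absurd (hrel a₀ ha₀ _ (Finset.mem_toRight.mp hj) j) (hdummy a₀ (hY ha₀) j).not_gt
      have hcard := W.card_toLeft_add_card_toRight
      rw [hright, Finset.card_empty, add_zero] at hcard
      rw [← hcard, ← Finset.card_map (Function.Embedding.subtype (· ∈ B))]
      refine hfree Y hY _ (fun b hb => ?_) (fun a ha b hb i => ?_) hYk
      · obtain ⟨b, -, rfl⟩ := Finset.mem_map.mp hb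
        exact b.2
      · obtain ⟨b, hb', rfl⟩ := Finset.mem_map.mp hb
        exact (hlt a _ i).mp (hrel a ha _ (Finset.mem_toLeft.mp hb') i))
  obtain ⟨a₀, ha₀⟩ := hA
  have hB : 4 * s ≤ B.card := (hdeg a₀ ha₀).trans (Finset.card_filter_le _ _)
  have hB' : (4 : ℝ) * s ≤ B.card := by exact_mod_cast hB
  have hk' : (1 : ℝ) ≤ k := by exact_mod_cast hk
  have hsk : (s : ℝ) = 1000000 * k := by rw [hs]; push_cast; rfl
  have hBA' : (B.card : ℝ) ≤ A.card := by exact_mod_cast hBA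
  have hcard : (Fintype.card (B ⊕ Fin 3) : ℝ) = B.card + 3 := by simp
  rw [hcard] at hbound
  have h1 : ((B.card : ℝ) + 3) / (4 * s) + 6 ≤ 8 * B.card / (4 * s) := by
    have hs0 : (0 : ℝ) < 4 * s := by rw [hsk]; positivity
    rw [div_add' _ _ _ hs0.ne']
    gcongr
    linarith
  -- The constant in `s` is chosen to make this factor less than 1.
  have h2 : 442368 * (k : ℝ) * (8 * B.card / (4 * s)) = 884736 / 1000000 * B.card := by
    rw [hsk]
    field_simp
    ring
  have h3 := mul_le_mul_of_nonneg_left h1 (show (0 : ℝ) ≤ 442368 * k by positivity)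
  linarith

/-! ### Edge bound for dominance graphs. -/

open Classical in
/-- A three-dimensional dominance graph without `K_{k,k}` has `O(k (n + m))` edges. -/
theorem card_dominance_le {α β : Type*} (A : Finset α) (B : Finset β)
    (x : α → Fin 3 → ℝ) (y : β → Fin 3 → ℝ) {k : ℕ} (hk : 1 ≤ k)
    (hfree : ∀ Y ⊆ A, ∀ W ⊆ B, (∀ a ∈ Y, ∀ b ∈ W, x a ≤ y b) → k ≤ Y.card → W.card < k) :
    ∑ a ∈ A, (B.filter fun b => x a ≤ y b).card ≤ 4 * (1000000 * k) * (A.card + B.card) := by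
  classical
  induction hn : A.card + B.card generalizing A B with
  | zero =>
    rw [Finset.card_eq_zero.mp (show A.card = 0 by omega)]
    simp
  | succ n ih =>
    rcases le_total B.card A.card with hBA | hAB
    · obtain ⟨a, ha, hdeg⟩ := exists_dominance_degree_lt A B x y hk
        (Finset.card_pos.mp (by omega)) hBA hfree
      have h := ih (A.erase a) B (fun Y hY => hfree Y (hY.trans (Finset.erase_subset _ _)))
        (by rw [Finset.card_erase_of_mem ha]; omega)
      rw [← Finset.add_sum_erase A _ ha]
      linarith
    · obtain ⟨b, hb, hdeg⟩ := exists_dominance_degree_lt B A (fun b => -y b) (fun a => -x a) hk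
        (Finset.card_pos.mp (by omega)) hAB (fun Y hY W hW h hYk => by
          by_contra! hWk
          exact absurd (hfree W hW Y hY (fun a ha b hb => neg_le_neg_iff.mp (h b hb a ha)) hWk)
            hYk.not_gt)
      simp only [neg_le_neg_iff] at hdeg
      have h := ih A (B.erase b)
        (fun Y hY W hW => hfree Y hY W (hW.trans (Finset.erase_subset _ _)))
        (by rw [Finset.card_erase_of_mem hb]; omega)
      have hcomm : ∀ B : Finset β, ∑ a ∈ A, (B.filter fun b => x a ≤ y b).card =
          ∑ b ∈ B, (A.filter fun a => x a ≤ y b).card := fun B =>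
        Finset.sum_card_bipartiteAbove_eq_sum_card_bipartiteBelow fun a b => x a ≤ y b
      rw [hcomm] at h ⊢
      rw [← Finset.add_sum_erase B _ hb]
      linarith

/-! ### From incidences to dominance. -/

/-- Without `K_{k,k}`, no `k` points share `k` regions. -/
theorem IncidenceKFree.card_lt {X : Type*} {k : ℕ} {P : Finset X} {B : Finset (Set X)}
    (h : IncidenceKFree k P B) {Y : Finset X} (hY : Y ⊆ P) {W : Finset (Set X)} (hW : W ⊆ B)
    (hYW : ∀ p ∈ Y, ∀ R ∈ W, p ∈ R) (hYk : k ≤ Y.card) : W.card < k := by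
  by_contra! hWk
  obtain ⟨u⟩ := Function.Embedding.nonempty_of_card_le (α := Fin k) (β := Y) (by simpa using hYk)
  obtain ⟨v⟩ := Function.Embedding.nonempty_of_card_le (α := Fin k) (β := W) (by simpa using hWk)
  refine h ⟨⟨⟨Sum.map (fun i => ⟨u i, hY (u i).2⟩) (fun i => ⟨v i, hW (v i).2⟩), ?_⟩, ?_⟩⟩
  · rintro (i | i) (j | j) hij
    · simp at hij
    · exact hYW _ (u i).2 _ (v j).2
    · exact hYW _ (u j).2 _ (v i).2
    · simp at hij
  · refine Function.Injective.sumMap (fun i j hij => ?_) fun i j hij => ?_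
    · exact u.injective (Subtype.ext (congrArg (Subtype.val : P → X) hij))
    · exact v.injective (Subtype.ext (congrArg (Subtype.val : B → Set X) hij))

theorem numIncidences_le_sum {X : Type*} (P : Finset X) (B : Finset (Set X))
    [∀ (R : Set X) (p : X), Decidable (p ∈ R)] :
    numIncidences P B ≤ ∑ p ∈ P, (B.filter fun R => p ∈ R).card := by
  classical
  have hsub : (incidenceGraph P B).edgeSet ⊆
      ((P.attach.sigma fun p => B.attach.filter fun R => p.1 ∈ R.1).image
        fun q => (s(Sum.inl q.1, Sum.inr q.2) : Sym2 (P ⊕ B)) : Finset (Sym2 (P ⊕ B))) := by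
    intro e
    induction e with
    | _ u v =>
      intro huv
      rw [SimpleGraph.mem_edgeSet] at huv
      simp only [Finset.coe_image, Set.mem_image, Finset.mem_coe, Finset.mem_sigma,
        Finset.mem_attach, Finset.mem_filter, true_and]
      rcases u with p | R <;> rcases v with q | S
      · exact huv.elim
      · exact ⟨⟨p, S⟩, huv, rfl⟩
      · exact ⟨⟨q, R⟩, huv, Sym2.eq_swap⟩
      · exact huv.elim
  calc numIncidences P B ≤ _ := Set.ncard_le_ncard hsub (Finset.finite_toSet _)
    _ ≤ _ := by rw [Set.ncard_coe_finset]; exact Finset.card_image_le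
    _ = ∑ p ∈ P.attach, (B.attach.filter fun R => p.1 ∈ R.1).card := Finset.card_sigma _ _
    _ = ∑ p ∈ P.attach, (B.filter fun R => p.1 ∈ R).card := by
      refine Finset.sum_congr rfl fun p _ => ?_
      rw [Finset.filter_attach (fun R => p.1 ∈ R) B]
      simp
    _ = _ := Finset.sum_attach P fun p => (B.filter fun R => p ∈ R).card

/-- If every region is of one of finitely many types, and incidences with regions of each type
are described by three-dimensional dominance, then `K_{k,k}`-free incidence graphs have
`O(k (n + m))` edges. -/
theorem numIncidences_le_of_dominance {X ι : Type*} [Fintype ι] [Nonempty ι] (k : ℕ) (P : Finset X)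
    (B : Finset (Set X)) (x : ι → X → Fin 3 → ℝ)
    (hB : ∀ R ∈ B, ∃ (i : ι) (y : Fin 3 → ℝ), ∀ p, p ∈ R ↔ x i p ≤ y)
    (h : IncidenceKFree k P B) :
    numIncidences P B ≤ Fintype.card ι * 4000000 * (k * (P.card + B.card)) := by
  classical
  -- `K_{0,0}` is contained in every graph, so the case `k = 0` is vacuous.
  rcases Nat.eq_zero_or_pos k with rfl | hk
  · exact absurd (h.card_lt (Finset.empty_subset P) (Finset.empty_subset B) (by simp) le_rfl)
      (by simp)
  choose! c y hy using hB
  have hi : ∀ i, ∑ p ∈ P, ((B.filter fun R => c R = i).filter fun R => p ∈ R).card ≤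
      4000000 * (k * (P.card + B.card)) := by
    intro i
    have e : ∀ p, ((B.filter fun R => c R = i).filter fun R => p ∈ R) =
        (B.filter fun R => c R = i).filter fun R => x i p ≤ y R := by
      intro p
      refine Finset.filter_congr fun R hR => ?_
      obtain ⟨hRB, hRi⟩ := Finset.mem_filter.mp hR
      rw [hy R hRB, hRi]
    simp only [e]
    refine (card_dominance_le P (B.filter fun R => c R = i) (x i) y hk ?_).trans ?_
    · intro Y hY W hW hYW
      refine h.card_lt hY (hW.trans (Finset.filter_subset _ _)) fun p hp R hR => ?_
      obtain ⟨hRB, hRi⟩ := Finset.mem_filter.mp (hW hR)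
      rw [hy R hRB, hRi]
      exact hYW p hp R hR
    · have := Finset.card_filter_le B fun R => c R = i
      calc _ ≤ 4 * (1000000 * k) * (P.card + B.card) := by gcongr
        _ = _ := by ring
  calc numIncidences P B ≤ ∑ p ∈ P, (B.filter fun R => p ∈ R).card := numIncidences_le_sum P B
    _ = ∑ p ∈ P, ∑ i, ((B.filter fun R => c R = i).filter fun R => p ∈ R).card := by
      refine Finset.sum_congr rfl fun p _ => ?_
      rw [Finset.card_eq_sum_card_fiberwise (f := c) (t := Finset.univ)
        fun _ _ => Finset.mem_coe.mpr (Finset.mem_univ _)]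
      exact Finset.sum_congr rfl fun i _ => by rw [Finset.filter_comm]
    _ = ∑ i, ∑ p ∈ P, ((B.filter fun R => c R = i).filter fun R => p ∈ R).card := Finset.sum_comm
    _ ≤ ∑ i : ι, 4000000 * (k * (P.card + B.card)) := Finset.sum_le_sum fun i _ => hi i
    _ = _ := by rw [Finset.sum_const, Finset.card_univ, smul_eq_mul, mul_assoc]

theorem IsOrthant.exists_dominance {R : Set (Fin 3 → ℝ)} (hR : IsOrthant R) :
    ∃ (s : Fin 3 → Bool) (y : Fin 3 → ℝ),
      ∀ p, p ∈ R ↔ (fun i => if s i then p i else -p i) ≤ y := by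
  obtain ⟨q, s, rfl⟩ := hR
  refine ⟨s, fun i => if s i then q i else -q i, fun p => forall_congr' fun i => ?_⟩
  cases h : s i <;> simp [h]

theorem IsThreeSidedRectangle.exists_dominance {R : Set (Fin 2 → ℝ)}
    (hR : IsThreeSidedRectangle R) :
    ∃ (s : Fin 2 × Fin 2 × Bool) (y : Fin 3 → ℝ),
      ∀ p, p ∈ R ↔ ![-p s.1, p s.1, if s.2.2 then p s.2.1 else -p s.2.1] ≤ y := by
  obtain ⟨i, j, a, b, h, -, -, rfl | rfl⟩ := hR
  · refine ⟨(i, j, true), ![-a, b, h], fun p => ?_⟩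
    simp [Pi.le_def, Fin.forall_fin_succ, and_assoc]
  · refine ⟨(i, j, false), ![-a, b, -h], fun p => ?_⟩
    simp [Pi.le_def, Fin.forall_fin_succ, and_assoc]

theorem mainTheorem9 :
    (∃ C : ℝ, 0 < C ∧
      ∀ (k n m : ℕ) (P : Finset (Fin 3 → ℝ)) (B : Finset (Set (Fin 3 → ℝ))),
        P.card = n → B.card = m → (∀ R ∈ B, IsOrthant R) → IncidenceKFree k P B →
          (numIncidences P B : ℝ) ≤ C * (k * (n + m))) ∧
    (∃ C : ℝ, 0 < C ∧
      ∀ (k n m : ℕ) (P : Finset (Fin 2 → ℝ)) (B : Finset (Set (Fin 2 → ℝ))),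
        P.card = n → B.card = m → (∀ R ∈ B, IsThreeSidedRectangle R) → IncidenceKFree k P B →
          (numIncidences P B : ℝ) ≤ C * (k * (n + m))) := by
  -- Eight types at 4000000 each; the index pairs with equal axes in the planar case are harmless.
  refine ⟨⟨32000000, by norm_num, ?_⟩, ⟨32000000, by norm_num, ?_⟩⟩
  · rintro k n m P B rfl rfl hB hfree
    have := numIncidences_le_of_dominance k P B
      (fun (s : Fin 3 → Bool) p i => if s i then p i else -p i)
      (fun R hR => (hB R hR).exists_dominance) hfree
    simp only [Fintype.card_fun, Fintype.card_bool, Fintype.card_fin] at this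
    norm_num at this
    exact_mod_cast this
  · rintro k n m P B rfl rfl hB hfree
    have := numIncidences_le_of_dominance k P B
      (fun (s : Fin 2 × Fin 2 × Bool) p =>
        ![-p s.1, p s.1, if s.2.2 then p s.2.1 else -p s.2.1])
      (fun R hR => (hB R hR).exists_dominance) hfree
    simp only [Fintype.card_prod, Fintype.card_bool, Fintype.card_fin] at this
    norm_num at this
    exact_mod_cast this
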